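/- A hypergraph $H=(V(H),E(H))$ here has a finite vertex set, its hyperedges are subsets of $V(H)$ of arbitrary sizes (an \emph{edge} is a hyperedge with two vertices), and it is vertex-weighted: each vertex $x$ has a positive integer weight $w(x)$. Let its product weight be $$PW(H)=\max\Big\{\prod_{x\in e}w(x) : e\in E(H)\Big\}.$$ A length-$n$ vector over $\mathbb Z_g$ is balanced if each symbol of $\mathbb Z_g$ occurs $\lfloor n/g\rfloor$ or $\lceil n/g\rceil$ times in it. Length-$n$ vectors $x_1$ over $\mathbb Z_{g_1}$ and $x_2$ over $\mathbb Z_{g_2}$ are pairwise balanced if both are balanced and each pair $(a,b)\in\mathbb Z_{g_1}\times\mathbb Z_{g_2}$ occurs in $(x_1,x_2)$ exactly $\lfloor n/(g_1g_2)\rfloor$ or $\lceil n/(g_1g_2)\rceil$ times. A covering array (CA) of size $n$ on $H$ is an array with $n$ columns and one row for each vertex $x$ of $H$, with entries from $\mathbb Z_{w(x)}$ in row $x$, such that for every hyperedge $e$ each tuple of symbols in $\prod_{x\in e}\mathbb Z_{w(x)}$ occurs in at least one column of the rows of $e$. It is balanced if every row is balanced and the rows of any two distinct vertices of a common hyperedge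 are pairwise balanced. \textbf{Proposition.} Let $n$ be a positive integer and let $H$ be a vertex-weighted hypergraph with a hyperedge $\{v,w,z\}$, where $v,w,z$ are distinct. Let $H'$ be the vertex-weighted hypergraph obtained from $H$ by single-vertex hyperedge hooking II: add a new vertex $u$ of positive integer weight $w(u)$, a new hyperedge $\{u,v,w\}$ and a new edge $\{u,z\}$, keeping all other vertices, weights and hyperedges. Assume that $PW(H)=PW(H')$ and that, if $w(u)\ge 3$, $$\Big\lfloor\frac{n}{w(v)w(w)}\Big\rfloor\equiv 0 \pmod{w(u)}.$$ Then there exists a balanced CA of size $n$ on $H$ if and only if there exists a balanced CA of size $n$ on $H'$. -/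

import Mathlib

/-! Vectors of length `n` over the alphabet `ZMod g` are functions `Fin n → ZMod g`, with `0 < g`
in every use. -/

/-- A family of length-`n` vectors (with alphabet `ZMod (g i)` for the `i`-th one) is qualitatively
independent if every tuple of symbols occurs in at least one column. For a family indexed by a
`t`-element type this is `t`-qualitative independence. -/
def QualitativelyIndependent {ι : Type*} {g : ι → ℕ} {n : ℕ}
    (x : (i : ι) → Fin n → ZMod (g i)) : Prop :=
  ∀ a : (i : ι) → ZMod (g i), ∃ j : Fin n, ∀ i : ι, x i j = a i

/-- Every symbol occurs `⌊n/g⌋` or `⌈n/g⌉` times. -/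
def BalancedVector {g n : ℕ} (x : Fin n → ZMod g) : Prop :=
  ∀ a : ZMod g,
    (Finset.univ.filter fun j => x j = a).card = n / g ∨
      (Finset.univ.filter fun j => x j = a).card = n ⌈/⌉ g

/-- Both vectors are balanced, and every pair of symbols occurs `⌊n/(g₁g₂)⌋` or `⌈n/(g₁g₂)⌉`
times. -/
def PairwiseBalanced {g₁ g₂ n : ℕ} (x : Fin n → ZMod g₁) (y : Fin n → ZMod g₂) : Prop :=
  BalancedVector x ∧ BalancedVector y ∧
    ∀ (a : ZMod g₁) (b : ZMod g₂),
      (Finset.univ.filter fun j => x j = a ∧ y j = b).card = n / (g₁ * g₂) ∨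
        (Finset.univ.filter fun j => x j = a ∧ y j = b).card = n ⌈/⌉ (g₁ * g₂)

/-- A covering array of size `n` on the hypergraph `H` with vertex weights `wt`: one row per vertex
`x`, with entries in `ZMod (wt x)`, such that the rows of the vertices of each hyperedge are
qualitatively independent. -/
def IsCoveringArray {α : Type*} (H : Hypergraph α) (wt : α → ℕ) (n : ℕ)
    (C : (x : H.vertexSet) → Fin n → ZMod (wt x)) : Prop :=
  ∀ (e : Set α) (he : e ∈ H.edgeSet),
    QualitativelyIndependent (g := fun x : e => wt x)
      (fun x : e => C ⟨x, H.mem_vertexSet_of_mem_edgeSet he x.2⟩)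

/-- A covering array in which every row is balanced and the rows of any two distinct vertices of a
common hyperedge are pairwise balanced. -/
def IsBalancedCoveringArray {α : Type*} (H : Hypergraph α) (wt : α → ℕ) (n : ℕ)
    (C : (x : H.vertexSet) → Fin n → ZMod (wt x)) : Prop :=
  IsCoveringArray H wt n C ∧
    (∀ x : H.vertexSet, BalancedVector (C x)) ∧
    ∀ e ∈ H.edgeSet, ∀ x y : H.vertexSet,
      (x : α) ∈ e → (y : α) ∈ e → x ≠ y → PairwiseBalanced (C x) (C y)

/-- The product weight of a (finite) vertex-weighted hypergraph: the largest product of the weights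
of the vertices of a hyperedge, over all hyperedges. -/
noncomputable def productWeight {α : Type*} (H : Hypergraph α) (wt : α → ℕ) : ℕ :=
  sSup ((fun e : Set α => ∏ᶠ x ∈ e, wt x) '' H.edgeSet)

/-- `H'` arises from `H` by inserting a new vertex `u`, a new hyperedge `{u, v, w}` and a new edge
`{u, z}`, where `{v, w, z}` is an existing hyperedge with three vertices. -/
structure IsSingleVertexHyperedgeHookingII {α : Type*} (H H' : Hypergraph α) (u v w z : α) :
    Prop where
  new_vertex : u ∉ H.vertexSet
  v_ne_w : v ≠ w
  v_ne_z : v ≠ z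
  w_ne_z : w ≠ z
  old_edge : {v, w, z} ∈ H.edgeSet
  vertexSet_eq : H'.vertexSet = insert u H.vertexSet
  edgeSet_eq : H'.edgeSet = H.edgeSet ∪ {{u, v, w}, {u, z}}

/-! ### Equitable 2-colourings of two partitions -/

/-- Two involutions of a finite type can be 2-coloured simultaneously: there is a colouring that
changes along every nontrivial orbit of either. -/
theorem exists_bool_coloring_of_involutive {X : Type*} [Finite X] (σ τ : X → X)
    (hσ : Function.Involutive σ) (hτ : Function.Involutive τ) :
    ∃ ε : X → Bool, (∀ x, σ x ≠ x → ε (σ x) ≠ ε x) ∧ (∀ x, τ x ≠ x → ε (τ x) ≠ ε x) := by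
  classical
  have : Fintype X := Fintype.ofFinite X
  generalize hk : (Finset.univ.filter fun x => τ x ≠ x).card = k
  induction k using Nat.strong_induction_on generalizing σ τ with
  | _ k ih =>
  by_cases hid : ∀ x, τ x = x
  · obtain ⟨m, ⟨e⟩⟩ := Finite.exists_equiv_fin X
    refine ⟨fun x => decide (e x < e (σ x)), fun x hx => ?_, fun x hx => absurd (hid x) hx⟩
    have h1 : e (σ x) ≠ e x := fun h => hx (e.injective h)
    change decide (e (σ x) < e (σ (σ x))) ≠ decide (e x < e (σ x))
    rw [hσ x]
    rcases lt_or_gt_of_ne h1 with h | h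
    · simp [h, h.le]
    · simp [h, h.le]
  · push Not at hid
    obtain ⟨x, hx⟩ := hid
    obtain ⟨y, hy⟩ : ∃ y, y = τ x := ⟨_, rfl⟩
    have hyx : τ y = x := by rw [hy, hτ x]
    have hxy : y ≠ x := hy ▸ hx
    -- Contract the path σ x – x – y – σ y: both maps now fix x and y, and σ' joins the outer
    -- neighbours σ x and σ y directly when both exist.
    let τ' : X → X := fun z => if z = x ∨ z = y then z else τ z
    let σ' : X → X := fun z => if z = x ∨ z = y then z
      else if σ z = x then (if σ y = y ∨ σ y = x then z else σ y)
      else if σ z = y then (if σ x = x then z else σ x) else σ z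
    have hτ' : Function.Involutive τ' := by
      intro z
      have := hτ z
      grind
    have hσ' : Function.Involutive σ' := by
      intro z
      have h1 := hσ z
      have h2 := hσ x
      have h3 := hσ y
      grind
    have hlt : (Finset.univ.filter fun z => τ' z ≠ z).card < k := by
      rw [← hk]
      apply Finset.card_lt_card
      rw [Finset.ssubset_iff_of_subset]
      · exact ⟨x, by simp [hx], by simp [τ']⟩
      · intro z
        simp only [Finset.mem_filter, Finset.mem_univ, true_and]
        grind
    obtain ⟨ε, h1, h2⟩ := ih _ hlt σ' τ' hσ' hτ' rfl
    -- b will colour x and its negation y. Both constraints can hold because σ' forces σ x and σ y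
    -- to have opposite colours.
    obtain ⟨b, hb1, hb2⟩ : ∃ b : Bool, (σ x ≠ x → σ x ≠ y → ε (σ x) = !b) ∧
        (σ y ≠ y → σ y ≠ x → ε (σ y) = b) := by
      by_cases hsx : σ x ≠ x ∧ σ x ≠ y
      · refine ⟨!(ε (σ x)), fun _ _ => by simp, fun e1 e2 => ?_⟩
        have e3 := h1 (σ x)
        have e4 : σ' (σ x) = σ y := by
          have := hσ x
          grind
        have e5 : σ y ≠ σ x := fun h => hxy (hσ.injective h)
        rw [e4] at e3
        exact Bool.eq_not.2 (e3 e5)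
      · exact ⟨ε (σ y), fun e1 e2 => absurd ⟨e1, e2⟩ hsx, fun _ _ => rfl⟩
    refine ⟨fun z => if z = x then b else if z = y then !b else ε z, fun z hz => ?_, fun z hz => ?_⟩
    · have e1 := h1 z
      have k1 := hσ z
      by_cases hzx : z = x
      · subst hzx
        clear ih hσ' hτ' hlt h1 h2
        grind
      by_cases hzy : z = y
      · subst hzy
        clear ih hσ' hτ' hlt h1 h2
        grind
      by_cases hszx : σ z = x
      · clear ih hσ' hτ' hlt h1 h2
        grind
      by_cases hszy : σ z = y
      · clear ih hσ' hτ' hlt h1 h2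
        grind
      have e2 : σ' z = σ z := by simp only [σ', hzx, hzy, hszx, hszy, or_self, if_false]
      simp only [hzx, hzy, hszx, hszy, if_false]
      rw [e2] at e1
      exact e1 hz
    · have e1 := h2 z
      have k1 := hτ z
      clear ih hσ' hτ' hlt h1 h2 hb1 hb2 hσ
      grind

/-- A finite set admits an involution with at most one fixed point. -/
theorem exists_involutive_on_finset {X : Type*} [DecidableEq X] (S : Finset X) :
    ∃ σ : X → X, Function.Involutive σ ∧ (∀ x ∉ S, σ x = x) ∧ (∀ x ∈ S, σ x ∈ S) ∧
      ∀ x ∈ S, ∀ y ∈ S, σ x = x → σ y = y → x = y := by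
  induction S using Finset.strongInduction with
  | _ S ih =>
  by_cases hS : ∀ x ∈ S, ∀ y ∈ S, x = y
  · exact ⟨id, fun _ => rfl, fun _ _ => rfl, fun _ h => h, fun x hx y hy _ _ => hS x hx y hy⟩
  · push Not at hS
    obtain ⟨a, ha, b, hb, hab⟩ := hS
    obtain ⟨σ, h1, h2, h3, h4⟩ := ih ((S.erase a).erase b)
      (lt_of_le_of_lt (Finset.erase_subset _ _) (Finset.erase_ssubset ha))
    simp only [Finset.mem_erase] at h2 h3 h4
    refine ⟨fun x => if x = a then b else if x = b then a else σ x, ?_, ?_, ?_, ?_⟩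
    · intro x
      have := h1 x
      grind
    · grind
    · grind
    · grind

/-- If an involution preserves `S`, has at most one fixed point there, and changes the colour of
every other point, then the two colours are almost equally frequent on `S`. -/
theorem card_filter_le_of_involutive {X : Type*} [DecidableEq X] (S : Finset X) (σ : X → X)
    (hσ : Function.Involutive σ) (hS : ∀ x ∈ S, σ x ∈ S)
    (hfix : ∀ x ∈ S, ∀ y ∈ S, σ x = x → σ y = y → x = y)
    (ε : X → Bool) (hε : ∀ x ∈ S, σ x ≠ x → ε (σ x) ≠ ε x) (b : Bool) :
    (S.filter fun x => ε x = b).card ≤ (S.filter fun x => ε x = !b).card + 1 := by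
  have h1 : (S.filter fun x => ε x = b) ⊆
      ((S.filter fun x => ε x = !b).image σ) ∪ S.filter fun x => σ x = x := by
    intro x hx
    simp only [Finset.mem_filter, Finset.mem_union, Finset.mem_image] at hx ⊢
    by_cases h : σ x = x
    · exact Or.inr ⟨hx.1, h⟩
    · refine Or.inl ⟨σ x, ⟨hS x hx.1, ?_⟩, hσ x⟩
      have := hε x hx.1 h
      rw [hx.2] at this
      cases b <;> simpa using this
  have h2 : (S.filter fun x => σ x = x).card ≤ 1 := by
    rw [Finset.card_le_one]
    intro x hx y hy
    simp only [Finset.mem_filter] at hx hy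
    exact hfix x hx.1 y hy.1 hx.2 hy.2
  calc _ ≤ _ := Finset.card_le_card h1
    _ ≤ _ := Finset.card_union_le _ _
    _ ≤ _ := Nat.add_le_add Finset.card_image_le h2

/-- An involution which pairs off each fibre of `f` on `D`, up to at most one point, and then pairs
off the remaining points of `D`, up to at most one. -/
theorem exists_involutive_fiberwise {X A : Type*} [DecidableEq X] [DecidableEq A] (f : X → A)
    (D : Finset X) :
    ∃ σ₀ σ : X → X, Function.Involutive σ₀ ∧ Function.Involutive σ ∧
      (∀ x, f (σ₀ x) = f x) ∧ (∀ x ∈ D, σ₀ x ∈ D) ∧ (∀ x ∈ D, σ x ∈ D) ∧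
      (∀ x, σ₀ x ≠ x → σ x = σ₀ x) ∧
      (∀ x ∈ D, ∀ y ∈ D, f x = f y → σ₀ x = x → σ₀ y = y → x = y) ∧
      (∀ x ∈ D, ∀ y ∈ D, σ x = x → σ y = y → x = y) := by
  choose ρ h1 h2 h3 h4 using fun a : A => exists_involutive_on_finset (D.filter fun x => f x = a)
  simp only [Finset.mem_filter] at h2 h3 h4
  -- τ pairs the leftovers of different fibres, which gives balance on all of D.
  obtain ⟨τ, t1, t2, t3, t4⟩ := exists_involutive_on_finset (D.filter fun x => ρ (f x) x = x)
  simp only [Finset.mem_filter] at t2 t3 t4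
  have hf : ∀ x, f (ρ (f x) x) = f x := by
    intro x
    by_cases hx : x ∈ D
    · exact (h3 (f x) x ⟨hx, rfl⟩).2
    · rw [h2 (f x) x (fun h => hx h.1)]
  have hinv : Function.Involutive fun x => ρ (f x) x := fun x => by
    simp only [hf]
    exact h1 _ x
  have hD : ∀ x ∈ D, ρ (f x) x ∈ D := fun x hx => (h3 (f x) x ⟨hx, rfl⟩).1
  have huniq : ∀ x ∈ D, ∀ y ∈ D, f x = f y → ρ (f x) x = x → ρ (f y) y = y → x = y :=
    fun x hx y hy hxy e1 e2 => h4 (f x) x ⟨hx, rfl⟩ y ⟨hy, hxy.symm⟩ e1 (by rw [hxy]; exact e2)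
  obtain ⟨s, hs⟩ : ∃ s : X → X, ∀ x, s x = ρ (f x) x := ⟨_, fun _ => rfl⟩
  simp only [← hs] at hf hinv hD huniq t2 t3 t4
  clear h1 h2 h3 h4 hs
  refine ⟨s, fun x => if s x = x then τ x else s x, hinv, ?_, hf, hD, ?_, ?_, huniq, ?_⟩
  · intro x
    have k1 := hinv x
    have k2 := t1 x
    have k3 := t2 x
    have k4 := t3 x
    by_cases hx : s x = x
    · by_cases hxD : x ∈ D
      · simp [hx, (k4 ⟨hxD, hx⟩).2, k2]
      · simp [hx, k3 (fun h => hxD h.1)]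
    · have : s (s x) ≠ s x := fun h => hx (hinv.injective h)
      simp only [if_neg hx, if_neg this]
      exact k1
  · intro x hx
    have k1 := hD x hx
    have k2 := t3 x
    by_cases h : s x = x
    · simpa [h] using (k2 ⟨hx, h⟩).1
    · simpa [h] using k1
  · intro x hx
    simp only [if_neg hx]
  · intro x hx y hy e1 e2
    have k1 := t4 x
    clear huniq t1 t2 t3 hinv hf hD
    grind

/-! ### From two colours to any number -/

/-- Among pairs of natural numbers with given sum, nearly equal ones minimise the sum of squares. -/
theorem sq_add_sq_le_of_near {a b a' b' : ℕ} (h : a + b = a' + b') (h1 : a ≤ b + 1)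
    (h2 : b ≤ a + 1) : a ^ 2 + b ^ 2 ≤ a' ^ 2 + b' ^ 2 := by
  rcases lt_trichotomy a' b' with h3 | h3 | h3
  · zify at *
    nlinarith [sq_nonneg ((a : ℤ) - b)]
  · obtain rfl : a = b := by omega
    obtain rfl : a' = a := by omega
    rw [h3]
  · zify at *
    nlinarith [sq_nonneg ((a : ℤ) - b)]

theorem sq_add_sq_lt_of_near {a b a' b' : ℕ} (h : a + b = a' + b') (h1 : a ≤ b + 1)
    (h2 : b ≤ a + 1) (h3 : b' + 1 < a') : a ^ 2 + b ^ 2 < a' ^ 2 + b' ^ 2 := by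
  zify at *
  nlinarith [sq_nonneg ((a : ℤ) - b)]

/-- The colours of `c` occur almost equally often on `S`. -/
def EquitableOn {X P : Type*} [DecidableEq P] (S : Finset X) (c : X → P) : Prop :=
  ∀ p q : P, (S.filter fun x => c x = p).card ≤ (S.filter fun x => c x = q).card + 1

/-- Two partitions, together with the whole set, admit an equitable 2-colouring. -/
theorem exists_bool_equitableOn {X A B : Type*} [Finite X] [DecidableEq X] [DecidableEq A]
    [DecidableEq B] (f : X → A) (h : X → B) (D : Finset X) :
    ∃ ε : X → Bool, (∀ a, EquitableOn (D.filter fun x => f x = a) ε) ∧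
      (∀ b, EquitableOn (D.filter fun x => h x = b) ε) ∧ EquitableOn D ε := by
  have key : ∀ (S : Finset X) (ε : X → Bool),
      (∀ b, (S.filter fun x => ε x = b).card ≤ (S.filter fun x => ε x = !b).card + 1) →
      EquitableOn S ε := by
    intro S ε hb p q
    by_cases hpq : q = p
    · subst hpq
      exact Nat.le_succ _
    · have : q = !p := by cases p <;> cases q <;> simp_all
      rw [this]
      exact hb p
  obtain ⟨σ₀, σ, a1, a2, a3, a4, a5, a6, a7, a8⟩ := exists_involutive_fiberwise f D
  obtain ⟨τ₀, τ, b1, b2, b3, b4, b5, b6, b7, b8⟩ := exists_involutive_fiberwise h D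
  -- The union of two matchings has only paths and even cycles, so one colouring serves both
  -- partitions.
  obtain ⟨ε, e1, e2⟩ := exists_bool_coloring_of_involutive σ τ a2 b2
  refine ⟨ε, fun a => key _ _ ?_, fun b => key _ _ ?_, key _ _ ?_⟩
  · refine card_filter_le_of_involutive _ σ₀ a1 ?_ ?_ ε ?_
    · intro x hx
      simp only [Finset.mem_filter] at hx ⊢
      exact ⟨a4 x hx.1, (a3 x).trans hx.2⟩
    · intro x hx y hy
      simp only [Finset.mem_filter] at hx hy
      exact a7 x hx.1 y hy.1 (hx.2.trans hy.2.symm)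
    · intro x _ hne
      have := a6 x hne
      exact this ▸ e1 x (this ▸ hne)
  · refine card_filter_le_of_involutive _ τ₀ b1 ?_ ?_ ε ?_
    · intro x hx
      simp only [Finset.mem_filter] at hx ⊢
      exact ⟨b4 x hx.1, (b3 x).trans hx.2⟩
    · intro x hx y hy
      simp only [Finset.mem_filter] at hx hy
      exact b7 x hx.1 y hy.1 (hx.2.trans hy.2.symm)
    · intro x _ hne
      have := b6 x hne
      exact this ▸ e2 x (this ▸ hne)
  · exact card_filter_le_of_involutive _ σ a2 a5 a8 ε fun x _ => e1 x

/-- A finite family of sets all of whose restrictions have an equitable 2-colouring has an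
equitable colouring with any nonempty finite set of colours. -/
theorem exists_equitableOn_of_bool {X K P : Type*} [Fintype X] [DecidableEq X] [Fintype K]
    [Fintype P] [Nonempty P] [DecidableEq P] (S : K → Finset X)
    (hS : ∀ D : Finset X, ∃ ε : X → Bool, ∀ k, EquitableOn (D ∩ S k) ε) :
    ∃ c : X → P, ∀ k, EquitableOn (S k) c := by
  let N : (X → P) → K → P → ℕ := fun c k p => ((S k).filter fun x => c x = p).card
  let Φ : (X → P) → ℕ := fun c => ∑ k, ∑ p, N c k p ^ 2
  -- Take a colouring minimising the sum of squared colour counts. If colours p and q are unbalanced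
  -- on some set, equitably recolouring their union lowers this sum.
  obtain ⟨c, hc⟩ := Finite.exists_min Φ
  refine ⟨c, fun k₀ p q => ?_⟩
  by_contra! hlt
  have hpq : p ≠ q := by
    rintro rfl
    omega
  obtain ⟨ε, hε⟩ := hS (Finset.univ.filter fun x => c x = p ∨ c x = q)
  let c' : X → P := fun x => if c x = p ∨ c x = q then (if ε x then p else q) else c x
  have hr : ∀ k r, r ≠ p → r ≠ q → N c' k r = N c k r := by
    intro k r h1 h2
    simp only [N]
    congr 1
    ext x
    simp only [Finset.mem_filter, c']
    grind
  have hp : ∀ k, N c' k p = (((Finset.univ.filter fun x => c x = p ∨ c x = q) ∩ S k).filter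
      fun x => ε x = true).card := by
    intro k
    simp only [N]
    congr 1
    ext x
    simp only [Finset.mem_filter, Finset.mem_inter, Finset.mem_univ, true_and, c']
    grind
  have hq : ∀ k, N c' k q = (((Finset.univ.filter fun x => c x = p ∨ c x = q) ∩ S k).filter
      fun x => ε x = false).card := by
    intro k
    simp only [N]
    congr 1
    ext x
    simp only [Finset.mem_filter, Finset.mem_inter, Finset.mem_univ, true_and, c']
    grind
  have hsum : ∀ k, N c' k p + N c' k q = N c k p + N c k q := by
    intro k
    simp only [N]
    rw [← Finset.card_union_of_disjoint, ← Finset.card_union_of_disjoint]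
    · congr 1
      ext x
      simp only [Finset.mem_filter, Finset.mem_union, c']
      grind
    · rw [Finset.disjoint_filter]
      grind
    · rw [Finset.disjoint_filter]
      grind
  have hsplit : ∀ d k, ∑ r, N d k r ^ 2 =
      N d k p ^ 2 + (N d k q ^ 2 + ∑ r ∈ (Finset.univ.erase p).erase q, N d k r ^ 2) := by
    intro d k
    rw [Finset.add_sum_erase (Finset.univ.erase p) (fun r => N d k r ^ 2) (by simp [hpq.symm]),
      Finset.add_sum_erase Finset.univ (fun r => N d k r ^ 2) (Finset.mem_univ p)]
  have hrest : ∀ k, ∑ r ∈ (Finset.univ.erase p).erase q, N c' k r ^ 2 =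
      ∑ r ∈ (Finset.univ.erase p).erase q, N c k r ^ 2 := by
    intro k
    refine Finset.sum_congr rfl fun r hr' => ?_
    simp only [Finset.mem_erase] at hr'
    rw [hr k r hr'.2.1 hr'.1]
  have hnear : ∀ k, N c' k p ≤ N c' k q + 1 ∧ N c' k q ≤ N c' k p + 1 := by
    intro k
    rw [hp, hq]
    exact ⟨hε k _ _, hε k _ _⟩
  have hsq : ∀ k, N c' k p ^ 2 + N c' k q ^ 2 ≤ N c k p ^ 2 + N c k q ^ 2 := by
    intro k
    exact sq_add_sq_le_of_near (hsum k) (hnear k).1 (hnear k).2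
  have hsq₀ : N c' k₀ p ^ 2 + N c' k₀ q ^ 2 < N c k₀ p ^ 2 + N c k₀ q ^ 2 :=
    sq_add_sq_lt_of_near (hsum k₀) (hnear k₀).1 (hnear k₀).2 hlt
  refine absurd (hc c') (not_le.2 ?_)
  refine Finset.sum_lt_sum (fun k _ => ?_) ⟨k₀, Finset.mem_univ _, ?_⟩
  · rw [hsplit, hsplit, hrest]
    have := hsq k
    omega
  · rw [hsplit, hsplit, hrest]
    omega

/-- Two partitions of a subset, together with the subset itself, admit an equitable colouring with
any nonempty finite set of colours. -/
theorem exists_equitableOn {X A B P : Type*} [Fintype X] [DecidableEq X] [Fintype A]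
    [DecidableEq A] [Fintype B] [DecidableEq B] [Fintype P] [Nonempty P] [DecidableEq P]
    (f : X → A) (h : X → B) (D : Finset X) :
    ∃ c : X → P, (∀ a, EquitableOn (D.filter fun x => f x = a) c) ∧
      (∀ b, EquitableOn (D.filter fun x => h x = b) c) ∧ EquitableOn D c := by
  obtain ⟨c, hc⟩ := exists_equitableOn_of_bool (P := P)
    (fun k : (A ⊕ B) ⊕ Unit => k.elim (fun i => i.elim (fun a => D.filter fun x => f x = a)
      (fun b => D.filter fun x => h x = b)) fun _ => D) (by
    intro E
    obtain ⟨ε, h1, h2, h3⟩ := exists_bool_equitableOn f h (E ∩ D)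
    refine ⟨ε, ?_⟩
    rintro ((a | b) | _)
    · simpa only [Sum.elim_inl, Sum.elim_inr, Finset.inter_filter]
        using h1 a
    · simpa only [Sum.elim_inl, Sum.elim_inr, Finset.inter_filter] using h2 b
    · exact h3)
  exact ⟨c, fun a => hc (.inl (.inl a)), fun b => hc (.inl (.inr b)), hc (.inr ())⟩

theorem sum_card_filter_color {X P : Type*} [Fintype P] [DecidableEq P] (S : Finset X)
    (c : X → P) : ∑ p, (S.filter fun x => c x = p).card = S.card :=
  (Finset.card_eq_sum_card_fiberwise fun _ _ => Finset.mem_coe.2 (Finset.mem_univ _)).symm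

/-! ### Nearly equal integers -/

/-- Nearly equal natural numbers lie between the floor and the ceiling of their mean. -/
theorem between_of_nearly_equal {P : Type*} [Fintype P] (N : P → ℕ)
    (h : ∀ p q, N p ≤ N q + 1) (p : P) :
    (∑ q, N q) / Fintype.card P ≤ N p ∧ N p ≤ (∑ q, N q) ⌈/⌉ Fintype.card P := by
  have hpos : 0 < Fintype.card P := Fintype.card_pos_iff.2 ⟨p⟩
  constructor
  · rw [← Nat.lt_succ_iff, Nat.div_lt_iff_lt_mul hpos]
    calc ∑ q, N q < ∑ _q : P, (N p + 1) :=
          Finset.sum_lt_sum (fun q _ => h q p) ⟨p, Finset.mem_univ _, Nat.lt_succ_self _⟩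
      _ = (N p).succ * Fintype.card P := by simp [mul_comm]
  · rw [Nat.ceilDiv_eq_add_pred_div, Nat.le_div_iff_mul_le hpos]
    have : ∑ _q : P, N p < ∑ q, (N q + 1) :=
      Finset.sum_lt_sum (fun q _ => h p q) ⟨p, Finset.mem_univ _, Nat.lt_succ_self _⟩
    simp only [Finset.sum_const, Finset.sum_add_distrib, Finset.card_univ, smul_eq_mul,
      mul_one] at this
    rw [mul_comm]
    omega

theorem ceilDiv_le_div_add_one {g : ℕ} (hg : 0 < g) (d : ℕ) : d ⌈/⌉ g ≤ d / g + 1 := by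
  rw [Nat.ceilDiv_eq_add_pred_div, ← Nat.add_div_right _ hg]
  exact Nat.div_le_div_right (by omega)

/-- Two families of nearly equal natural numbers with the same sum are permutations of each
other. -/
theorem exists_perm_of_nearly_equal {P : Type*} [Fintype P] (N₁ N₂ : P → ℕ)
    (h₁ : ∀ p q, N₁ p ≤ N₁ q + 1) (h₂ : ∀ p q, N₂ p ≤ N₂ q + 1) (hs : ∑ p, N₁ p = ∑ p, N₂ p) :
    ∃ π : Equiv.Perm P, ∀ p, N₂ (π p) = N₁ p := by
  classical
  -- Each value is the floor of the mean or one more, so the sum fixes how often each occurs.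
  have key : ∀ N : P → ℕ, (∀ p q, N p ≤ N q + 1) → ∀ p, N p = (∑ q, N q) / Fintype.card P +
      if N p = (∑ q, N q) / Fintype.card P + 1 then 1 else 0 := by
    intro N h p
    have h1 := between_of_nearly_equal N h p
    have h2 := ceilDiv_le_div_add_one (Fintype.card_pos_iff.2 ⟨p⟩) (∑ q, N q)
    split_ifs with h3 <;> omega
  have k₁ := key N₁ h₁
  have k₂ := key N₂ h₂
  rw [← hs] at k₂
  generalize (∑ q, N₁ q) / Fintype.card P = m at k₁ k₂
  have hc : Fintype.card {p // N₁ p = m + 1} = Fintype.card {p // N₂ p = m + 1} := by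
    rw [Finset.sum_congr rfl fun p _ => k₁ p, Finset.sum_congr rfl fun p _ => k₂ p,
      Finset.sum_add_distrib, Finset.sum_add_distrib] at hs
    simp only [Finset.sum_boole, Nat.cast_id] at hs
    rw [Fintype.card_subtype, Fintype.card_subtype]
    exact Nat.add_left_cancel hs
  let e := Fintype.equivOfCardEq hc
  refine ⟨e.extendSubtype, fun p => ?_⟩
  by_cases hp : N₁ p = m + 1
  · rw [e.extendSubtype_mem p hp, hp]
  · have := e.extendSubtype_not_mem p hp
    rw [k₁ p, k₂ (e.extendSubtype p), if_neg hp, if_neg this]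

/-! ### Colouring the columns for the new row -/

/-- Suppose that every cell of the common refinement of the partitions by `x` and `y` has size at
least the number of colours, is congruent to `0` or `1` modulo that number, and meets the fibre of
`z` over `γ₀`. Then there is a colouring which is equitable on all fibres of `x`, `y` and `z` and on
the whole set, and uses all colours on each cell. -/
theorem exists_equitable_extension {X A B Γ P : Type*} [Fintype X] [DecidableEq X] [Fintype A]
    [DecidableEq A] [Fintype B] [DecidableEq B] [Fintype Γ] [DecidableEq Γ] [Fintype P]
    [Nonempty P] [DecidableEq P] (x : X → A) (y : X → B) (z : X → Γ) (γ₀ : Γ)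
    (hmod : ∀ a b, (Finset.univ.filter fun j => x j = a ∧ y j = b).card % Fintype.card P ≤ 1)
    (hle : ∀ a b, Fintype.card P ≤ (Finset.univ.filter fun j => x j = a ∧ y j = b).card)
    (hγ : ∀ a b, ∃ j, x j = a ∧ y j = b ∧ z j = γ₀) :
    ∃ c : X → P, (∀ a, EquitableOn (Finset.univ.filter fun j => x j = a) c) ∧
      (∀ b, EquitableOn (Finset.univ.filter fun j => y j = b) c) ∧
      (∀ γ, EquitableOn (Finset.univ.filter fun j => z j = γ) c) ∧
      EquitableOn Finset.univ c ∧ ∀ a b p, ∃ j, x j = a ∧ y j = b ∧ c j = p := by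
  choose e ex ey ez using hγ
  -- One representative from each cell whose size is not divisible by the number of colours, always
  -- chosen in the fibre of `z` over `γ₀`.
  let L : Finset X := Finset.univ.filter fun j => j = e (x j) (y j) ∧
    (Finset.univ.filter fun i => x i = x j ∧ y i = y j).card % Fintype.card P ≠ 0
  -- The parts of `f` are the trimmed cells and, as the single part `none`, all of `L`.
  let f : X → Option (A × B) := fun j => if j ∈ L then none else some (x j, y j)
  have hL : ∀ j ∈ L, z j = γ₀ := by
    intro j hj
    rw [(Finset.mem_filter.1 hj).2.1]
    exact ez _ _
  obtain ⟨c₁, h1x, h1y, h1L⟩ := exists_equitableOn (P := P) x y L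
  obtain ⟨c₂, h2f, h2z, -⟩ := exists_equitableOn (P := P) f z Finset.univ
  have hfL : (Finset.univ.filter fun j => f j = none) = L := by
    ext j
    by_cases hj : j ∈ L <;> simp [f, hj]
  let M : A × B → Finset X := fun ab => Finset.univ.filter fun j => f j = some ab
  have hmemM : ∀ ab j, j ∈ M ab ↔ j ∉ L ∧ (x j, y j) = ab := by
    intro ab j
    by_cases hj : j ∈ L <;> simp [M, f, hj]
  have hMcard : ∀ ab, Fintype.card P ∣ (M ab).card ∧ 0 < (M ab).card := by
    rintro ⟨a, b⟩
    have k1 := hmod a b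
    have k2 := hle a b
    have k3 : 0 < Fintype.card P := Fintype.card_pos
    by_cases h0 : (Finset.univ.filter fun j => x j = a ∧ y j = b).card % Fintype.card P = 0
    · have : M (a, b) = Finset.univ.filter fun j => x j = a ∧ y j = b := by
        ext j
        rw [hmemM]
        simp only [L, Finset.mem_filter, Finset.mem_univ, true_and, Prod.mk.injEq]
        constructor
        · exact fun h => h.2
        · rintro ⟨rfl, rfl⟩
          exact ⟨fun h => h.2 h0, rfl, rfl⟩
      rw [this]
      exact ⟨Nat.dvd_of_mod_eq_zero h0, k3.trans_le k2⟩
    · have : M (a, b) = (Finset.univ.filter fun j => x j = a ∧ y j = b).erase (e a b) := by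
        ext j
        rw [hmemM]
        simp only [L, Finset.mem_filter, Finset.mem_univ, true_and, Prod.mk.injEq, Finset.mem_erase]
        constructor
        · rintro ⟨h, rfl, rfl⟩
          exact ⟨fun h' => h ⟨h', h0⟩, rfl, rfl⟩
        · rintro ⟨h, rfl, rfl⟩
          exact ⟨fun h' => h h'.1, rfl, rfl⟩
      rw [this, Finset.card_erase_of_mem (by simp [ex, ey])]
      have h1 : (Finset.univ.filter fun j => x j = a ∧ y j = b).card % Fintype.card P = 1 := by
        omega
      -- With at least two colours and a cell at least that large, removing one column leaves a
      -- nonempty cell.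
      have h2 : Fintype.card P ≠ 1 := by
        intro h
        rw [h, Nat.mod_one] at h0
        exact h0 rfl
      refine ⟨?_, by omega⟩
      rw [← h1]
      exact Nat.dvd_sub_mod _
  have hMexact : ∀ ab p, ((M ab).filter fun j => c₂ j = p).card = (M ab).card / Fintype.card P := by
    intro ab p
    have h1 := between_of_nearly_equal _ (h2f (some ab)) p
    rw [sum_card_filter_color] at h1
    change (M ab).card / _ ≤ ((M ab).filter fun j => c₂ j = p).card ∧
      ((M ab).filter fun j => c₂ j = p).card ≤ (M ab).card ⌈/⌉ _ at h1
    obtain ⟨⟨k, hk⟩, -⟩ := hMcard ab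
    have k3 : 0 < Fintype.card P := Fintype.card_pos
    have h2 : (M ab).card / Fintype.card P = k := by rw [hk, Nat.mul_div_cancel_left _ k3]
    have h3 : (M ab).card ⌈/⌉ Fintype.card P ≤ k := by
      rw [ceilDiv_le_iff_le_mul k3, hk]
    omega
  -- After renaming colours by `π`, `c₁` has the same colour counts on `L` as `c₂`.
  obtain ⟨π, hπ⟩ := exists_perm_of_nearly_equal _ _ h1L (hfL ▸ h2f none) (by
    rw [sum_card_filter_color, sum_card_filter_color])
  let c : X → P := fun j => if j ∈ L then π (c₁ j) else c₂ j
  have hsplit : ∀ (S : Finset X) p, (S.filter fun j => c j = p).card =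
      ((S.filter fun j => j ∉ L).filter fun j => c₂ j = p).card +
        ((S.filter fun j => j ∈ L).filter fun j => c₁ j = π.symm p).card := by
    intro S p
    rw [← Finset.card_union_of_disjoint]
    · congr 1
      ext j
      by_cases hj : j ∈ L <;>
        simp [c, hj, Equiv.eq_symm_apply]
    · rw [Finset.disjoint_left]
      intro j
      simp only [Finset.mem_filter]
      tauto
  -- On any union of cells the trimmed parts contribute equally to every colour, so only `L` can
  -- cause imbalance.
  have hcells : ∀ Q : A × B → Prop, ∀ _ : DecidablePred Q,
      EquitableOn (L.filter fun j => Q (x j, y j)) c₁ →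
      EquitableOn (Finset.univ.filter fun j => Q (x j, y j)) c := by
    intro Q _ hQ p q
    have h1 : ∀ r, (((Finset.univ.filter fun j => Q (x j, y j)).filter fun j => j ∉ L).filter
        fun j => c₂ j = r).card = ∑ ab ∈ Finset.univ.filter Q, (M ab).card / Fintype.card P := by
      intro r
      rw [Finset.card_eq_sum_card_fiberwise (f := fun j => (x j, y j))
        (t := Finset.univ.filter Q)]
      · refine Finset.sum_congr rfl fun ab hab => ?_
        rw [← hMexact ab r]
        congr 1
        ext j
        have hab' := (Finset.mem_filter.1 hab).2
        simp only [Finset.mem_filter, Finset.mem_univ, true_and, hmemM]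
        constructor
        · tauto
        · rintro ⟨⟨h1, h2⟩, h3⟩
          exact ⟨⟨⟨h2 ▸ hab', h1⟩, h3⟩, h2⟩
      · intro j hj
        simp only [Finset.coe_filter, Finset.mem_filter, Finset.mem_univ, true_and,
          Set.mem_ofPred_eq] at hj ⊢
        exact hj.1.1
    have h2 : ((Finset.univ.filter fun j => Q (x j, y j)).filter fun j => j ∈ L) =
        L.filter fun j => Q (x j, y j) := by
      ext j
      simp [and_comm]
    rw [hsplit, hsplit, h1, h1, h2, add_assoc]
    exact Nat.add_le_add_left (hQ _ _) _
  -- A fibre of `z` either misses `L` or contains all of it; in both cases gluing preserves the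
  -- counts of `c₂`.
  have hzfib : ∀ γ p, ((Finset.univ.filter fun j => z j = γ).filter fun j => c j = p).card =
      ((Finset.univ.filter fun j => z j = γ).filter fun j => c₂ j = p).card := by
    intro γ p
    rw [hsplit, ← Finset.card_filter_add_card_filter_not
      (s := (Finset.univ.filter fun j => z j = γ).filter fun j => c₂ j = p) (fun j => j ∉ L)]
    congr 1
    · rw [Finset.filter_comm]
    · by_cases hγ' : γ = γ₀
      · subst hγ'
        have h1 := hπ (π.symm p)
        rw [Equiv.apply_symm_apply] at h1
        have h2 : ((Finset.univ.filter fun j => z j = γ).filter fun j => j ∈ L) = L := by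
          ext j
          simpa using hL j
        rw [h2, ← h1]
        congr 1
        ext j
        simp only [Finset.mem_filter, Finset.mem_univ, true_and, not_not]
        have := hL j
        tauto
      · rw [Finset.card_eq_zero.2, Finset.card_eq_zero.2]
        · ext j
          simp only [Finset.mem_filter, Finset.mem_univ, true_and, not_not, Finset.notMem_empty,
            iff_false]
          rintro ⟨⟨h, -⟩, h'⟩
          exact hγ' (h ▸ hL j h')
        · ext j
          simp only [Finset.mem_filter, Finset.mem_univ, true_and, Finset.notMem_empty,
            iff_false]
          rintro ⟨⟨h, h'⟩, -⟩
          exact hγ' (h ▸ hL j h')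
  refine ⟨c, fun a => hcells (fun ab => ab.1 = a) _ (h1x a),
    fun b => hcells (fun ab => ab.2 = b) _ (h1y b), fun γ p q => ?_, ?_, fun a b p => ?_⟩
  · rw [hzfib, hzfib]
    exact h2z γ p q
  · have := hcells (fun _ => True) (fun _ => inferInstance) (by simpa using h1L)
    simpa using this
  · have h1 := hMexact (a, b) p
    obtain ⟨h2, h3⟩ := hMcard (a, b)
    have h4 : 0 < ((M (a, b)).filter fun j => c₂ j = p).card := by
      rw [h1]
      exact Nat.div_pos (Nat.le_of_dvd h3 h2) Fintype.card_pos
    obtain ⟨j, hj⟩ := Finset.card_pos.1 h4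
    rw [Finset.mem_filter, hmemM] at hj
    obtain ⟨⟨hj1, hj2⟩, hj3⟩ := hj
    simp only [Prod.mk.injEq] at hj2
    exact ⟨j, hj2.1, hj2.2, by simp [c, hj1, hj3]⟩

/-! ### From equitable colourings to balanced vectors -/

theorem ceilDiv_ceilDiv_le {a b : ℕ} (ha : 0 < a) (hb : 0 < b) (n : ℕ) :
    (n ⌈/⌉ b) ⌈/⌉ a ≤ n ⌈/⌉ (a * b) := by
  rw [ceilDiv_le_iff_le_mul ha, ceilDiv_le_iff_le_mul hb, ← mul_assoc, mul_comm b a,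
    ← ceilDiv_le_iff_le_mul (Nat.mul_pos ha hb)]

theorem EquitableOn.balancedVector {g n : ℕ} (hg : 0 < g) {c : Fin n → ZMod g}
    (h : EquitableOn Finset.univ c) : BalancedVector c := by
  have : NeZero g := ⟨hg.ne'⟩
  intro a
  have h1 := between_of_nearly_equal _ h a
  rw [sum_card_filter_color, ZMod.card, Finset.card_univ, Fintype.card_fin] at h1
  have h2 := ceilDiv_le_div_add_one hg n
  omega

/-- Each fibre of `x` has ⌊n/g'⌋ or ⌈n/g'⌉ columns. Nested floors and ceilings collapse, so every
pair count lies between ⌊n/(gg')⌋ and ⌈n/(gg')⌉, which differ by at most one. -/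
theorem EquitableOn.pairwiseBalanced {g g' n : ℕ} (hg : 0 < g) (hg' : 0 < g')
    {c : Fin n → ZMod g} {x : Fin n → ZMod g'} (hc : BalancedVector c) (hx : BalancedVector x)
    (h : ∀ b, EquitableOn (Finset.univ.filter fun j => x j = b) c) : PairwiseBalanced c x := by
  have : NeZero g := ⟨hg.ne'⟩
  refine ⟨hc, hx, fun a b => ?_⟩
  have h1 := between_of_nearly_equal _ (h b) a
  rw [sum_card_filter_color, ZMod.card, Finset.filter_filter] at h1
  simp only [and_comm (a := x _ = b)] at h1
  have h2 := ceilDiv_le_div_add_one (Nat.mul_pos hg hg') n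
  have h3 := ceilDiv_ceilDiv_le hg hg' n
  have h4 : n / (g * g') = n / g' / g := by rw [Nat.div_div_eq_div_mul, mul_comm]
  have h5 : n / g' ≤ n ⌈/⌉ g' := by
    rw [Nat.ceilDiv_eq_add_pred_div]
    exact Nat.div_le_div_right (by omega)
  have h6 : n / g' / g ≤ (n ⌈/⌉ g') / g := Nat.div_le_div_right h5
  have h7 : (n / g') ⌈/⌉ g ≤ (n ⌈/⌉ g') ⌈/⌉ g := by
    rw [Nat.ceilDiv_eq_add_pred_div, Nat.ceilDiv_eq_add_pred_div]
    exact Nat.div_le_div_right (by omega)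
  rcases hx b with hb | hb <;> rw [hb] at h1 <;> omega

theorem PairwiseBalanced.symm {g₁ g₂ n : ℕ} {x : Fin n → ZMod g₁} {y : Fin n → ZMod g₂}
    (h : PairwiseBalanced x y) : PairwiseBalanced y x := by
  refine ⟨h.2.1, h.1, fun a b => ?_⟩
  simpa only [and_comm, mul_comm] using h.2.2 b a

/-! ### Size bounds and the hooking equivalence -/

/-- The product of the alphabet sizes of qualitatively independent vectors is at most their
length. -/
theorem QualitativelyIndependent.prod_le {ι : Type*} [Fintype ι] {g : ι → ℕ} {n : ℕ}
    (hg : ∀ i, 0 < g i) {x : (i : ι) → Fin n → ZMod (g i)} (h : QualitativelyIndependent x) :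
    ∏ i, g i ≤ n := by
  classical
  have : ∀ i, NeZero (g i) := fun i => ⟨(hg i).ne'⟩
  have h1 : Function.Surjective fun (j : Fin n) (i : ι) => x i j := fun a =>
    (h a).imp fun j hj => funext hj
  have h2 := Fintype.card_le_of_surjective _ h1
  simpa [Fintype.card_pi, ZMod.card] using h2

/-- The size of a covering array is at least the product weight. -/
theorem IsCoveringArray.productWeight_le {α : Type*} {H : Hypergraph α} {wt : α → ℕ} {n : ℕ}
    {C : (x : H.vertexSet) → Fin n → ZMod (wt x)} (hfin : H.vertexSet.Finite)
    (hwt : ∀ x ∈ H.vertexSet, 0 < wt x) (hC : IsCoveringArray H wt n C)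
    (hne : H.edgeSet.Nonempty) : productWeight H wt ≤ n := by
  refine csSup_le (hne.image _) ?_
  rintro _ ⟨e, he, rfl⟩
  have : Fintype e := (hfin.subset (H.subset_vertexSet_of_mem_edgeSet' he)).fintype
  change ∏ᶠ x ∈ e, wt x ≤ n
  rw [← finprod_set_coe_eq_finprod_mem, finprod_eq_prod_of_fintype]
  exact (hC e he).prod_le fun i => hwt _ (H.mem_vertexSet_of_mem_edgeSet he i.2)

theorem prod_le_productWeight {α : Type*} {H : Hypergraph α} (hfin : H.vertexSet.Finite)
    (wt : α → ℕ) {e : Set α} (he : e ∈ H.edgeSet) : ∏ᶠ x ∈ e, wt x ≤ productWeight H wt := by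
  have : H.edgeSet.Finite :=
    hfin.finite_subsets.subset fun _ h => H.subset_vertexSet_of_mem_edgeSet' h
  exact le_csSup (this.image _).bddAbove ⟨e, he, rfl⟩

/-- Rows can be chosen for a new vertex joined to three qualitatively independent rows. -/
theorem exists_new_row {n g a b d : ℕ} (hg : 0 < g) (ha : 0 < a) (hb : 0 < b) (hd : 0 < d)
    (x : Fin n → ZMod a) (y : Fin n → ZMod b) (z : Fin n → ZMod d)
    (hxy : PairwiseBalanced x y) (hz : BalancedVector z)
    (hqi : ∀ p q r, ∃ j, x j = p ∧ y j = q ∧ z j = r)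
    (hn : g * (a * b) ≤ n) (hdiv : 3 ≤ g → n / (a * b) ≡ 0 [MOD g]) :
    ∃ c : Fin n → ZMod g, BalancedVector c ∧ PairwiseBalanced c x ∧ PairwiseBalanced c y ∧
      PairwiseBalanced c z ∧ ∀ p q r, ∃ j, c j = p ∧ x j = q ∧ y j = r := by
  have : NeZero g := ⟨hg.ne'⟩
  have : NeZero a := ⟨ha.ne'⟩
  have : NeZero b := ⟨hb.ne'⟩
  have : NeZero d := ⟨hd.ne'⟩
  have hab : 0 < a * b := Nat.mul_pos ha hb
  have hm : g ≤ n / (a * b) := (Nat.le_div_iff_mul_le hab).2 hn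
  have hcell : ∀ p q, (Finset.univ.filter fun j => x j = p ∧ y j = q).card = n / (a * b) ∨
      (Finset.univ.filter fun j => x j = p ∧ y j = q).card = n / (a * b) + 1 := by
    intro p q
    have h1 := hxy.2.2 p q
    have h2 := ceilDiv_le_div_add_one hab n
    have h3 : n / (a * b) ≤ n ⌈/⌉ (a * b) := by
      rw [Nat.ceilDiv_eq_add_pred_div]
      exact Nat.div_le_div_right (by omega)
    omega
  obtain ⟨c, cx, cy, cz, ct, cc⟩ := exists_equitable_extension (P := ZMod g) x y z 0
    (fun p q => by
      rw [ZMod.card]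
      -- For g ≤ 2 every residue is at most 1, which is why divisibility is needed only from 3 on.
      rcases Nat.lt_or_ge g 3 with h | h
      · have := Nat.mod_lt (Finset.univ.filter fun j => x j = p ∧ y j = q).card hg
        omega
      · have h0 : n / (a * b) % g = 0 := hdiv h
        rcases hcell p q with h1 | h1
        · rw [h1, h0]
          exact Nat.zero_le _
        · rw [h1, Nat.add_mod, h0, zero_add, Nat.mod_mod]
          exact Nat.mod_le _ _)
    (fun p q => by
      rw [ZMod.card]
      rcases hcell p q with h1 | h1 <;> omega)
    (fun p q => hqi p q 0)
  have hc := ct.balancedVector hg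
  refine ⟨c, hc, EquitableOn.pairwiseBalanced hg ha hc hxy.1 cx,
    EquitableOn.pairwiseBalanced hg hb hc hxy.2.1 cy, EquitableOn.pairwiseBalanced hg hd hc hz cz,
    fun p q r => ?_⟩
  obtain ⟨j, h1, h2, h3⟩ := cc q r p
  exact ⟨j, h3, h1, h2⟩

/-- Pairwise balanced vectors whose length is at least the product of the alphabet sizes are
qualitatively independent. -/
theorem PairwiseBalanced.exists_eq {g₁ g₂ n : ℕ} {x : Fin n → ZMod g₁} {y : Fin n → ZMod g₂}
    (h : PairwiseBalanced x y) (hpos : 0 < g₁ * g₂) (hn : g₁ * g₂ ≤ n) (a : ZMod g₁)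
    (b : ZMod g₂) : ∃ j, x j = a ∧ y j = b := by
  have h1 : 0 < n / (g₁ * g₂) := Nat.div_pos hn hpos
  have h2 : n / (g₁ * g₂) ≤ n ⌈/⌉ (g₁ * g₂) := by
    rw [Nat.ceilDiv_eq_add_pred_div]
    exact Nat.div_le_div_right (by omega)
  have h3 : 0 < (Finset.univ.filter fun j => x j = a ∧ y j = b).card := by
    have := h.2.2 a b
    omega
  obtain ⟨j, hj⟩ := Finset.card_pos.1 h3
  exact ⟨j, (Finset.mem_filter.1 hj).2⟩

theorem mainTheorem11 {α : Type*} (H H' : Hypergraph α) (hfin : H.vertexSet.Finite)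
    (u v w z : α) (hook : IsSingleVertexHyperedgeHookingII H H' u v w z)
    (wt : α → ℕ) (hwt : ∀ x ∈ H'.vertexSet, 0 < wt x)
    (hPW : productWeight H wt = productWeight H' wt)
    (n : ℕ) (hn : 0 < n)
    (hdiv : 3 ≤ wt u → n / (wt v * wt w) ≡ 0 [MOD wt u]) :
    (∃ C : (x : H.vertexSet) → Fin n → ZMod (wt x), IsBalancedCoveringArray H wt n C) ↔
      (∃ C : (x : H'.vertexSet) → Fin n → ZMod (wt x), IsBalancedCoveringArray H' wt n C) := by
  classical
  obtain ⟨hu, hvw, hvz, hwz, hold, hV, hE⟩ := hook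
  have hsub : H.vertexSet ⊆ H'.vertexSet := hV ▸ Set.subset_insert _ _
  have hEsub : H.edgeSet ⊆ H'.edgeSet := hE ▸ Set.subset_union_left
  constructor
  · rintro ⟨C, hC⟩
    -- Extend the rows by zero outside `H`, so that they can be indexed by all of α and updated at
    -- `u`.
    obtain ⟨D, rfl⟩ : ∃ D : (x : α) → Fin n → ZMod (wt x), C = fun x : H.vertexSet => D x :=
      ⟨fun x => if h : x ∈ H.vertexSet then C ⟨x, h⟩ else 0, by
        funext x
        simp only [Subtype.coe_prop, dite_true]⟩
    obtain ⟨hCA, hbal, hpair⟩ := hC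
    have hv : v ∈ H.vertexSet := H.mem_vertexSet_of_mem_edgeSet hold (by simp)
    have hw : w ∈ H.vertexSet := H.mem_vertexSet_of_mem_edgeSet hold (by simp)
    have hz : z ∈ H.vertexSet := H.mem_vertexSet_of_mem_edgeSet hold (by simp)
    have hne : ∀ x ∈ H.vertexSet, x ≠ u := fun x hx h => hu (h ▸ hx)
    have hfin' : H'.vertexSet.Finite := hV ▸ hfin.insert u
    have hposu : 0 < wt u := hwt u (hV ▸ Set.mem_insert _ _)
    have hpos : ∀ x ∈ H.vertexSet, 0 < wt x := fun x hx => hwt x (hsub hx)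
    -- The equality of product weights carries the size bound over to the new hyperedges.
    have hPn : productWeight H' wt ≤ n := hPW ▸ hCA.productWeight_le hfin hpos ⟨_, hold⟩
    have hnew₁ : ({u, v, w} : Set α) ∈ H'.edgeSet := by simp [hE]
    have hnew₂ : ({u, z} : Set α) ∈ H'.edgeSet := by simp [hE]
    have hn₁ : wt u * (wt v * wt w) ≤ n := by
      refine le_trans (le_of_eq ?_) ((prod_le_productWeight hfin' wt hnew₁).trans hPn)
      rw [finprod_mem_insert _ (by simp [(hne v hv).symm, (hne w hw).symm]) (Set.toFinite _),
        finprod_mem_pair hvw]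
    have hn₂ : wt u * wt z ≤ n := by
      refine le_trans (le_of_eq ?_) ((prod_le_productWeight hfin' wt hnew₂).trans hPn)
      rw [finprod_mem_pair (hne z hz).symm]
    have hqi : ∀ p q r, ∃ j, D v j = p ∧ D w j = q ∧ D z j = r := by
      intro p q r
      obtain ⟨j, hj⟩ := hCA _ hold fun i =>
        Function.update (Function.update (Function.update (fun x => (0 : ZMod (wt x))) v p) w q) z r
          i
      refine ⟨j, ?_, ?_, ?_⟩
      · have := hj ⟨v, by simp⟩
        simpa [hvw, hvz] using this
      · have := hj ⟨w, by simp⟩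
        simpa [hwz] using this
      · have := hj ⟨z, by simp⟩
        simpa using this
    obtain ⟨c, hc, hcv, hcw, hcz, hcc⟩ := exists_new_row hposu (hpos v hv) (hpos w hw) (hpos z hz)
      (D v) (D w) (D z)
      (hpair _ hold ⟨v, hv⟩ ⟨w, hw⟩ (by simp) (by simp) (by simpa using hvw))
      (hbal ⟨z, hz⟩) hqi hn₁ hdiv
    obtain ⟨F, hFu, hF⟩ : ∃ F : (x : α) → Fin n → ZMod (wt x), F u = c ∧ ∀ x, x ≠ u → F x = D x :=
      ⟨Function.update D u c, by simp, fun x hx => by simp [hx]⟩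
    have hFv := hF v (hne v hv)
    have hFw := hF w (hne w hw)
    have hFz := hF z (hne z hz)
    subst hFu
    rw [← hFv] at hcv hcc
    rw [← hFw] at hcw hcc
    rw [← hFz] at hcz
    have hpair' : ∀ e ∈ H.edgeSet, ∀ x ∈ e, ∀ y ∈ e, x ≠ y → PairwiseBalanced (F x) (F y) := by
      intro e he x hx y hy hxy
      have hx' := H.mem_vertexSet_of_mem_edgeSet he hx
      have hy' := H.mem_vertexSet_of_mem_edgeSet he hy
      rw [hF x (hne x hx'), hF y (hne y hy')]
      exact hpair e he ⟨x, hx'⟩ ⟨y, hy'⟩ hx hy (by simpa using hxy)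
    have hvw' := hpair' _ hold v (by simp) w (by simp) hvw
    refine ⟨fun x => F x, ?_, ?_, ?_⟩
    · intro e he
      rw [hE] at he
      rcases he with he | rfl | rfl
      · intro t
        obtain ⟨j, hj⟩ := hCA e he t
        refine ⟨j, fun i => ?_⟩
        have hi := hne i (H.mem_vertexSet_of_mem_edgeSet he i.2)
        exact (congrFun (hF i hi) j).trans (hj i)
      · intro t
        obtain ⟨j, h1, h2, h3⟩ := hcc (t ⟨u, by simp⟩) (t ⟨v, by simp⟩) (t ⟨w, by simp⟩)
        refine ⟨j, ?_⟩
        rintro ⟨i, hi⟩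
        have hi' := hi
        simp only [Set.mem_insert_iff, Set.mem_singleton_iff] at hi'
        rcases hi' with h | h | h
        · cases h
          exact h1
        · cases h
          exact h2
        · cases h
          exact h3
      · intro t
        -- Coverage of {u, z} follows from balance: every pair occurs at least ⌊n/(w(u)w(z))⌋ ≥ 1
        -- times.
        obtain ⟨j, h1, h2⟩ := hcz.exists_eq (Nat.mul_pos hposu (hpos z hz)) hn₂
          (t ⟨u, by simp⟩) (t ⟨z, by simp⟩)
        refine ⟨j, ?_⟩
        rintro ⟨i, hi⟩
        have hi' := hi
        simp only [Set.mem_insert_iff, Set.mem_singleton_iff] at hi'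
        rcases hi' with h | h
        · cases h
          exact h1
        · cases h
          exact h2
    · rintro ⟨x, hx⟩
      by_cases h : x = u
      · subst h
        exact hc
      · have hx' : x ∈ H.vertexSet := by
          rw [hV] at hx
          exact hx.resolve_left h
        change BalancedVector (F x)
        rw [hF x h]
        exact hbal ⟨x, hx'⟩
    · rintro e he ⟨x, hxV⟩ ⟨y, hyV⟩ hx hy hxy
      have hxy' : x ≠ y := fun h => hxy (Subtype.ext h)
      change PairwiseBalanced (F x) (F y)
      rw [hE] at he
      rcases he with he | rfl | rfl
      · exact hpair' e he x hx y hy hxy'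
      · simp only [Set.mem_insert_iff, Set.mem_singleton_iff] at hx hy
        clear hxy hxV hyV
        rcases hx with rfl | rfl | rfl <;> rcases hy with rfl | rfl | rfl <;>
          first
          | exact absurd rfl hxy'
          | assumption
          | exact PairwiseBalanced.symm (by assumption)
      · simp only [Set.mem_insert_iff, Set.mem_singleton_iff] at hx hy
        clear hxy hxV hyV
        rcases hx with rfl | rfl <;> rcases hy with rfl | rfl <;>
          first
          | exact absurd rfl hxy'
          | assumption
          | exact PairwiseBalanced.symm (by assumption)
  -- Conversely, delete the row of `u`.
  · rintro ⟨C, hCA, hbal, hpair⟩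
    refine ⟨fun x => C ⟨x, hsub x.2⟩, fun e he => hCA e (hEsub he), fun x => hbal _,
      fun e he x y hx hy hxy => hpair e (hEsub he) _ _ hx hy fun h => hxy ?_⟩
    exact Subtype.ext (congrArg (fun t : H'.vertexSet => (t : α)) h)
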